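/- For $m\ge 1$ let $B_m$ be the Artin braid group with canonical generators $\sigma_1,\dots,\sigma_{m-1}$ and relations $\sigma_i\sigma_j=\sigma_j\sigma_i$ ($|i-j|\ge 2$), $\sigma_i\sigma_{i+1}\sigma_i=\sigma_{i+1}\sigma_i\sigma_{i+1}$, and put $\alpha=\sigma_1\cdots\sigma_{m-1}$, $\beta=\alpha\sigma_1$ (with $\alpha=\beta=1$ if $m=1$). A pair $(a,b)$ in $B_m$ is a *special system of generators* if $a=\psi(\alpha)$, $b=\psi(\beta)$ for some automorphism $\psi$ of $B_m$; let $\mathcal H_m(a,b)$ be the set of all elements $g^{-1}a^pg$ and $g^{-1}b^pg$ with $g\in B_m$, $p\in\mathbb Z$. A homomorphism $\varphi\colon B_k\to B_n$ is *special* if $\varphi(\mathcal H_k(\alpha,\beta))\subseteq\mathcal H_n(a,b)$ for some special system of generators $(a,b)$ of $B_n$; it is *integral* if its image is a torsion free cyclic group (possibly trivial). Let $P^1(k),P^2(k),P^3(k),P^4(k)$ be the arithmetic progressions $\{c+jk(k-1): j=0,1,2,\dots\}$ with initial term $c=k$, $k(k-1)$, $k(k-1)+1$, $(k-1)^2$ respectively,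 and let $P(k)$ be their union. **Theorem (arithmetical properties of special homomorphisms $B_k\to B_n$).** Let $k\ne 4$ and let $\varphi\colon B_k\to B_n$ be a non-integral special homomorphism. Then $n\in P(k)$. More precisely, there are a special system of generators $(a,b)$ of $B_n$, an element $g\in B_n$ and integers $p,q$ such that at least one of the following holds: 1. $\varphi(\alpha)=a^p$ and $\varphi(\beta)=gb^qg^{-1}$; 2. $\varphi(\alpha)=a^p$ and $\varphi(\beta)=ga^qg^{-1}$; 3. $\varphi(\alpha)=b^p$ and $\varphi(\beta)=gb^qg^{-1}$; 4. $\varphi(\alpha)=b^p$ and $\varphi(\beta)=ga^qg^{-1}$. Moreover, for every special system of generators $(a,b)$ of $B_n$, every $g\in B_n$ and all integers $p,q$: (a) if 1 holds, then $n\in P^1(k)$ and there are integers $l\ge 0$ and $t$ with $n=k+lk(k-1)$, $\gcd(t,k(k-1))=1$, $p=t(l(k-1)+1)$, $q=t(lk+1)$; (b) if 2 holds, then $n\in P^2(k)$ and there are integers $l\ge 1$ and $t$ with $n=lk(k-1)$, $p=t(k-1)$, $q=tk$, and $g$ commutes with $a^{tk(k-1)}$; (c) if 3 holds, then $n\in P^3(k)$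 and there are integers $l\ge 1$ and $t$ with $n=lk(k-1)+1$, $p=t(k-1)$, $q=tk$, and $g$ commutes with $b^{tk(k-1)}$; (d) if 4 holds, then $n\in P^4(k)$ and there are integers $l\ge 1$ and $t$ with $n=(k-1)(lk-1)$, $\gcd(t,k(k-1))=1$, $p=t(l(k-1)-1)$, $q=t(lk-1)$. In particular, if $k\ne 4$ and $n\notin P(k)$, then every special homomorphism $B_k\to B_n$ is integral. -/

import Mathlib

/-- The defining relators of the Artin braid group on `m` strings; the generator with index
`i : Fin (m - 1)` is the canonical generator `σ_{i+1}`. -/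
def braidRelators (m : ℕ) : Set (FreeGroup (Fin (m - 1))) :=
  {r | ∃ i j : Fin (m - 1), (i : ℕ) + 2 ≤ (j : ℕ) ∧
      r = FreeGroup.of i * FreeGroup.of j * (FreeGroup.of j * FreeGroup.of i)⁻¹} ∪
  {r | ∃ i j : Fin (m - 1), (i : ℕ) + 1 = (j : ℕ) ∧
      r = FreeGroup.of i * FreeGroup.of j * FreeGroup.of i *
        (FreeGroup.of j * FreeGroup.of i * FreeGroup.of j)⁻¹}

/-- The Artin braid group `B_m` on `m` strings, by its canonical presentation
(the trivial group for `m ≤ 1`). -/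
abbrev BraidGroup (m : ℕ) : Type := PresentedGroup (braidRelators m)

namespace BraidGroup

/-- The canonical generators `σ_1, …, σ_{m-1}` of `B_m`, indexed from `0`. -/
def sigma (m : ℕ) (i : Fin (m - 1)) : BraidGroup m := PresentedGroup.of i

/-- `α = σ_1 σ_2 ⋯ σ_{m-1}`. -/
def alpha (m : ℕ) : BraidGroup m := ((List.finRange (m - 1)).map (sigma m)).prod

/-- `β = α σ_1` (for `m ≤ 1` the group is trivial and there is no `σ_1`; then `β = α = 1`). -/
def beta (m : ℕ) : BraidGroup m :=
  if h : 0 < m - 1 then alpha m * sigma m ⟨0, h⟩ else alpha m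

/-- `(a, b)` is a special system of generators of `B_m`: the image of `(α, β)` under some
automorphism of `B_m`. -/
def IsSpecialSystem {m : ℕ} (a b : BraidGroup m) : Prop :=
  ∃ ψ : BraidGroup m ≃* BraidGroup m, ψ (alpha m) = a ∧ ψ (beta m) = b

/-- The set `H_m(a, b)` of all conjugates of integer powers of `a` and of `b`. -/
def conjPowers {m : ℕ} (a b : BraidGroup m) : Set (BraidGroup m) :=
  {x | ∃ (g : BraidGroup m) (p : ℤ), x = g⁻¹ * a ^ p * g ∨ x = g⁻¹ * b ^ p * g}

/-- A homomorphism `φ : B_k → B_n` is special if it maps `H_k(α, β)` into `H_n(a, b)` for some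
special system of generators `(a, b)` of `B_n`. -/
def IsSpecialHom {k n : ℕ} (φ : BraidGroup k →* BraidGroup n) : Prop :=
  ∃ a b : BraidGroup n, IsSpecialSystem a b ∧
    φ '' conjPowers (alpha k) (beta k) ⊆ conjPowers a b

/-- A homomorphism is integral if its image is a torsion free cyclic group
(possibly trivial). -/
def IsIntegralHom {G H : Type*} [Group G] [Group H] (φ : G →* H) : Prop :=
  IsCyclic φ.range ∧ ∀ x ∈ φ.range, IsOfFinOrder x → x = 1

/-- The infinite arithmetic progression with difference `k (k - 1)` and initial term `c`. -/
def progression (k c : ℕ) : Set ℕ := {n | ∃ j : ℕ, n = c + j * (k * (k - 1))}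

/-- `P¹(k)`, starting at `k`. -/
def P1 (k : ℕ) : Set ℕ := progression k k

/-- `P²(k)`, starting at `k (k - 1)`. -/
def P2 (k : ℕ) : Set ℕ := progression k (k * (k - 1))

/-- `P³(k)`, starting at `k (k - 1) + 1`. -/
def P3 (k : ℕ) : Set ℕ := progression k (k * (k - 1) + 1)

/-- `P⁴(k)`, starting at `(k - 1)²`. -/
def P4 (k : ℕ) : Set ℕ := progression k ((k - 1) ^ 2)

/-- `P(k)`, the union of the four progressions. -/
def P (k : ℕ) : Set ℕ := P1 k ∪ P2 k ∪ P3 k ∪ P4 k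

end BraidGroup

/-! In `B_m` the elements `α`, `β` generate, `α^m = β^(m-1)` is central, and `σ_{i+1} = α^i σ_1
α^{-i}` with `σ_1 = α⁻¹β`. If `φ(α)` and `φ(β)` commute, the image is cyclic, generated by `φ(σ_1)`;
exponent sums and specialness make it torsion free. So a non-integral special `φ` has non-commuting
`φ(α)`, `φ(β)`.

In that case, for `k ≠ 4`, no smaller collapse is possible: `φ(α)^j` commutes with `φ(β)` only if `k
∣ j`, and `φ(β)^j` with `φ(α)` only if `k - 1 ∣ j` (`dvd_of_commute_alpha`, `dvd_of_commute_beta`).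
Specialness makes `φ(α)`, `φ(β)` conjugate to powers of `a` or `b`, whose `n`-th, respectively
`(n-1)`-th, powers are central. This gives divisibility constraints on `n`, and taking exponent sums
in `φ(α)^k = φ(β)^(k-1)` gives a linear relation between `p` and `q`. Together they determine `n`,
`p`, `q` (`arithmetic_standard`). -/

/-! ### Conjugation orbits satisfying braid relations, in an arbitrary group. -/

section GroupLemmas

variable {G : Type*} [Group G]

/-- The partial products `s 0 * ⋯ * s (m - 1)`. -/
def initialProd (s : ℕ → G) (m : ℕ) : G := ((List.range m).map s).prod

theorem initialProd_succ (s : ℕ → G) (m : ℕ) :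
    initialProd s (m + 1) = initialProd s m * s m := by
  simp [initialProd, List.range_succ]

theorem initialProd_commute (s : ℕ → G) {N : ℕ}
    (hc : ∀ i j, i + 2 ≤ j → j < N → Commute (s i) (s j)) {m j : ℕ} (hm : m < j) (hj : j < N) :
    Commute (initialProd s m) (s j) := by
  induction m with
  | zero => simp [initialProd]
  | succ m ih =>
    rw [initialProd_succ]
    exact (ih (by omega)).mul_left (hc m j (by omega) hj)

/-- The Coxeter-type product of braid generators shifts the generators. -/
theorem initialProd_mul (s : ℕ → G) {N : ℕ}
    (hc : ∀ i j, i + 2 ≤ j → j < N → Commute (s i) (s j))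
    (hb : ∀ i, i + 1 < N → s i * s (i + 1) * s i = s (i + 1) * s i * s (i + 1))
    {m i : ℕ} (him : i + 1 < m) (hm : m ≤ N) :
    initialProd s m * s i = s (i + 1) * initialProd s m := by
  induction m with
  | zero => omega
  | succ m ih =>
    rcases Nat.lt_or_ge (i + 1) m with h | h
    · rw [initialProd_succ, mul_assoc, ← (hc i m (by omega) (by omega)).eq, ← mul_assoc,
        ih h (by omega), mul_assoc]
    · obtain rfl : m = i + 1 := by omega
      have h1 := (initialProd_commute s hc (Nat.lt_succ_self i) (by omega : i + 1 < N)).eq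
      rw [initialProd_succ, initialProd_succ]
      calc initialProd s i * s i * s (i + 1) * s i
          = initialProd s i * (s i * s (i + 1) * s i) := by group
        _ = (initialProd s i * s (i + 1)) * s i * s (i + 1) := by rw [hb i (by omega)]; group
        _ = _ := by rw [h1]; group

/-- The orbit of `x` under conjugation by `a`. -/
def conjOrbit (a x : G) (i : ℕ) : G := a ^ i * x * (a ^ i)⁻¹

@[simp] theorem conjOrbit_zero (a x : G) : conjOrbit a x 0 = x := by simp [conjOrbit]

theorem conjOrbit_add (a x : G) (i j : ℕ) :
    conjOrbit a x (i + j) = a ^ i * conjOrbit a x j * (a ^ i)⁻¹ := by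
  simp only [conjOrbit, pow_add]; group

/-- Moving every `a` to the right turns the `i`-th `x` into its conjugate by `a^i`; the outer
conjugation by `a` shifts the indices from `0, …, m-1` to `1, …, m`. -/
theorem mul_pow_eq_initialProd (a x : G) (m : ℕ) :
    (a * x) ^ m = a * initialProd (conjOrbit a x) m * a⁻¹ * a ^ m := by
  induction m with
  | zero => simp [initialProd]
  | succ m ih =>
    rw [pow_succ, ih, initialProd_succ, conjOrbit]
    simp only [mul_assoc, inv_mul_cancel_left, pow_succ', mul_right_inj]
    group

theorem commute_conjOrbit_add {a x : G} {d : ℕ} (h : Commute x (conjOrbit a x d)) (i : ℕ) :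
    Commute (conjOrbit a x i) (conjOrbit a x (i + d)) := by
  rw [conjOrbit_add]
  exact h.map (MulAut.conj (a ^ i))

/-- If `x` satisfies the braid relations with its conjugates under powers of `a` and is fixed by
conjugation by `a ^ j`, then `x` commutes with `a`. -/
theorem commute_of_conjOrbit_eq {a x : G} {k j : ℕ} (hk : k ≠ 4)
    (hc : ∀ d, 2 ≤ d → d + 2 ≤ k → Commute x (conjOrbit a x d))
    (hb : x * conjOrbit a x 1 * x = conjOrbit a x 1 * x * conjOrbit a x 1)
    (hj : 1 ≤ j) (hjk : j + 2 ≤ k) (h : conjOrbit a x j = x) : Commute a x := by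
  have key : conjOrbit a x 1 = x → Commute a x := fun h1 => by
    have : a * x * a⁻¹ = x := by simpa [conjOrbit] using h1
    exact mul_inv_eq_iff_eq_mul.mp this
  have key2 : Commute x (conjOrbit a x 1) → Commute a x := fun h1 => by
    apply key
    have h2 := hb
    rw [h1.eq, mul_assoc _ x x, mul_assoc _ x (conjOrbit a x 1), mul_right_inj, mul_right_inj] at h2
    exact h2.symm
  -- With `x_i` the conjugate of `x` by `a^i`, it suffices that `x` commutes with `x_1`: the braid
  -- relation then forces `x_1 = x`. For `j = 2` this follows from `x_3 = x_1`, which needs `k ≥ 5`;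
  -- this is where `k ≠ 4` enters.
  rcases (by omega : j = 1 ∨ j = 2 ∨ 3 ≤ j) with rfl | rfl | h3
  · exact key h
  · apply key2
    have h4 := hc 3 (by norm_num) (by omega)
    have h5 : conjOrbit a x 3 = conjOrbit a x 1 := by
      rw [show 3 = 1 + 2 from rfl, conjOrbit_add, h]; rfl
    rwa [h5] at h4
  · apply key2
    have h4 := commute_conjOrbit_add (hc (j - 1) (by omega) (by omega)) 1
    rw [show 1 + (j - 1) = j by omega, h] at h4
    exact h4.symm

theorem commute_zpow_gcd {u x : G} {i j : ℤ} (hi : Commute (u ^ i) x) (hj : Commute (u ^ j) x) :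
    Commute (u ^ ((Int.gcd i j : ℕ) : ℤ)) x := by
  rw [Int.gcd_eq_gcd_ab, zpow_add, zpow_mul, zpow_mul]
  exact (hi.zpow_left _).mul_left (hj.zpow_left _)

/-- The exponent may be replaced by `d = gcd(j, k)`. A proper divisor satisfies `2d ≤ k`, hence `d +
2 ≤ k`, and `commute_of_conjOrbit_eq` would make `x` commute with `a`. -/
theorem dvd_of_commute_pow_left {a x : G} {k : ℕ} (hk3 : 3 ≤ k) (hk : k ≠ 4)
    (hc : ∀ d, 2 ≤ d → d + 2 ≤ k → Commute x (conjOrbit a x d))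
    (hb : x * conjOrbit a x 1 * x = conjOrbit a x 1 * x * conjOrbit a x 1)
    (hz : Commute (a ^ k) x) (hn : ¬ Commute a x) {j : ℤ} (hj : Commute (a ^ j) x) :
    (k : ℤ) ∣ j := by
  have hg := commute_zpow_gcd hj ((zpow_natCast a k).symm ▸ hz)
  set d := Int.gcd j k with hd
  have hdk : d ∣ k := by exact_mod_cast Int.gcd_dvd_right j k
  rw [zpow_natCast] at hg
  by_cases hdk' : d = k
  · have := Int.gcd_dvd_left j k
    rwa [← hd, hdk'] at this
  obtain ⟨e, he⟩ := hdk
  have hd0 : d ≠ 0 := by rintro h; rw [h] at he; omega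
  have he2 : 2 ≤ e := by
    rcases (by omega : e = 0 ∨ e = 1 ∨ 2 ≤ e) with rfl | rfl | h
    · omega
    · omega
    · exact h
  have : d * 2 ≤ k := he ▸ Nat.mul_le_mul_left d he2
  refine absurd (commute_of_conjOrbit_eq (j := d) hk hc hb (by omega) (by omega) ?_) hn
  rw [conjOrbit, hg.eq, mul_inv_cancel_right]

/-- Again pass to `d = gcd(j, k-1)`. Conjugation by `a * x` acts like conjugation by `a` on the
orbit elements that commute with `x`, so a proper divisor `d ≥ 2` gives `x_{2+d} = x_2`, hence `x_d
= x`. -/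
theorem dvd_of_commute_pow_right {a x : G} {k : ℕ} (hk3 : 3 ≤ k) (hk : k ≠ 4)
    (hc : ∀ d, 2 ≤ d → d + 2 ≤ k → Commute x (conjOrbit a x d))
    (hb : x * conjOrbit a x 1 * x = conjOrbit a x 1 * x * conjOrbit a x 1)
    (hz : Commute ((a * x) ^ (k - 1)) x) (hn : ¬ Commute a x) {j : ℤ}
    (hj : Commute ((a * x) ^ j) x) :
    (k : ℤ) - 1 ∣ j := by
  have hcast : ((k - 1 : ℕ) : ℤ) = (k : ℤ) - 1 := by omega
  rw [← hcast]
  have hg := commute_zpow_gcd hj ((zpow_natCast (a * x) (k - 1)).symm ▸ hz)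
  set d := Int.gcd j (k - 1 : ℕ) with hd
  have hdk : d ∣ k - 1 := by exact_mod_cast Int.gcd_dvd_right j (k - 1 : ℕ)
  rw [zpow_natCast] at hg
  by_cases hdk' : d = k - 1
  · have := Int.gcd_dvd_left j (k - 1 : ℕ)
    rwa [← hd, hdk'] at this
  obtain ⟨e, he⟩ := hdk
  have hd0 : d ≠ 0 := by rintro h; rw [h] at he; omega
  have he2 : 2 ≤ e := by
    rcases (by omega : e = 0 ∨ e = 1 ∨ 2 ≤ e) with rfl | rfl | h
    · omega
    · omega
    · exact h
  have hle : d * 2 ≤ k - 1 := he ▸ Nat.mul_le_mul_left d he2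
  by_cases hd1 : d = 1
  · rw [hd1, pow_one] at hg
    refine absurd ?_ hn
    have := hg.mul_left (Commute.refl x).inv_left
    simpa using this
  have hga : Commute ((a * x) ^ d) a := by
    have := ((Commute.refl (a * x)).pow_left d).mul_right hg.inv_right
    simpa using this
  -- conjugation by `a * x` shifts the part of the orbit which commutes with `x`
  have hshift : ∀ m, m + 3 ≤ k →
      (a * x) ^ m * conjOrbit a x 2 * ((a * x) ^ m)⁻¹ = conjOrbit a x (2 + m) := by
    intro m
    induction m with
    | zero => simp
    | succ m ih =>
      intro hm
      have h1 := hc (2 + m) (by omega) (by omega)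
      calc (a * x) ^ (m + 1) * conjOrbit a x 2 * ((a * x) ^ (m + 1))⁻¹
          = a * (x * ((a * x) ^ m * conjOrbit a x 2 * ((a * x) ^ m)⁻¹)) * x⁻¹ * a⁻¹ := by
            rw [pow_succ' (a * x) m]; simp only [mul_inv_rev, mul_assoc]
        _ = a ^ 1 * conjOrbit a x (2 + m) * (a ^ 1)⁻¹ := by
            rw [ih (by omega), h1.eq]; group
        _ = _ := by rw [← conjOrbit_add]; congr 1; omega
  refine absurd (commute_of_conjOrbit_eq (j := d) hk hc hb (by omega) (by omega) ?_) hn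
  have h2 := hshift d (by omega)
  have h3 : Commute ((a * x) ^ d) (conjOrbit a x 2) := by
    unfold conjOrbit
    exact ((hga.pow_right 2).mul_right hg).mul_right (hga.pow_right 2).inv_right
  rw [h3.eq, mul_inv_cancel_right, conjOrbit_add, conjOrbit] at h2
  simpa using h2.symm

end GroupLemmas

/-! ### The generators `α`, `β` and the central element `α^m = β^(m-1)`. -/

namespace BraidGroup

theorem sigma_commute {m : ℕ} {i j : Fin (m - 1)} (h : (i : ℕ) + 2 ≤ j) :
    Commute (sigma m i) (sigma m j) := by
  have : PresentedGroup.mk (braidRelators m)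
      (FreeGroup.of i * FreeGroup.of j * (FreeGroup.of j * FreeGroup.of i)⁻¹) = 1 :=
    PresentedGroup.one_of_mem (Or.inl ⟨i, j, h, rfl⟩)
  rw [map_mul, map_inv, mul_inv_eq_one, map_mul, map_mul] at this
  exact this

theorem sigma_braid {m : ℕ} {i j : Fin (m - 1)} (h : (i : ℕ) + 1 = j) :
    sigma m i * sigma m j * sigma m i = sigma m j * sigma m i * sigma m j := by
  have : PresentedGroup.mk (braidRelators m)
      (FreeGroup.of i * FreeGroup.of j * FreeGroup.of i *
        (FreeGroup.of j * FreeGroup.of i * FreeGroup.of j)⁻¹) = 1 :=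
    PresentedGroup.one_of_mem (Or.inr ⟨i, j, h, rfl⟩)
  rw [map_mul, map_inv, mul_inv_eq_one] at this
  simpa [sigma, PresentedGroup.of] using this

theorem subsingleton_of_le_one {m : ℕ} (hm : m ≤ 1) : Subsingleton (BraidGroup m) := by
  have : IsEmpty (Fin (m - 1)) := by
    rw [show m - 1 = 0 by omega]; infer_instance
  have h1 : (⊤ : Subgroup (BraidGroup m)) = ⊥ := by
    rw [← PresentedGroup.closure_range_of, Set.range_eq_empty, Subgroup.closure_empty]
  refine ⟨fun x y => ?_⟩
  have hx : x ∈ (⊤ : Subgroup (BraidGroup m)) := trivial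
  have hy : y ∈ (⊤ : Subgroup (BraidGroup m)) := trivial
  rw [h1, Subgroup.mem_bot] at hx hy
  rw [hx, hy]

/-- The generators as a sequence, continued by `1`. -/
def sigmaSeq (m i : ℕ) : BraidGroup m := if h : i < m - 1 then sigma m ⟨i, h⟩ else 1

theorem sigmaSeq_of_lt {m i : ℕ} (h : i < m - 1) : sigmaSeq m i = sigma m ⟨i, h⟩ := dif_pos h

theorem alpha_eq (m : ℕ) : alpha m = initialProd (sigmaSeq m) (m - 1) := by
  unfold alpha initialProd
  rw [← List.map_coe_finRange_eq_range, List.map_map]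
  congr 1
  refine List.map_congr_left fun i _ => ?_
  simp [sigmaSeq]

theorem beta_eq {m : ℕ} (hm : 2 ≤ m) : beta m = alpha m * sigmaSeq m 0 := by
  rw [beta, dif_pos (by omega), sigmaSeq_of_lt]

theorem sigmaSeq_commute {m : ℕ} (i j : ℕ) (h : i + 2 ≤ j) (hj : j < m - 1) :
    Commute (sigmaSeq m i) (sigmaSeq m j) := by
  rw [sigmaSeq_of_lt hj, sigmaSeq_of_lt (by omega : i < m - 1)]
  exact sigma_commute h

theorem sigmaSeq_braid {m : ℕ} (i : ℕ) (h : i + 1 < m - 1) :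
    sigmaSeq m i * sigmaSeq m (i + 1) * sigmaSeq m i =
      sigmaSeq m (i + 1) * sigmaSeq m i * sigmaSeq m (i + 1) := by
  rw [sigmaSeq_of_lt h, sigmaSeq_of_lt (by omega : i < m - 1)]
  exact sigma_braid rfl

theorem conjOrbit_alpha {m i : ℕ} (h : i < m - 1) :
    conjOrbit (alpha m) (sigmaSeq m 0) i = sigmaSeq m i := by
  induction i with
  | zero => simp
  | succ i ih =>
    rw [add_comm, conjOrbit_add, ih (by omega), pow_one, alpha_eq, add_comm,
      initialProd_mul _ sigmaSeq_commute sigmaSeq_braid h le_rfl, mul_inv_cancel_right]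

/-- Expand `(α σ_1)^(m-1)` by `mul_pow_eq_initialProd`: the orbit product is `σ_1 ⋯ σ_{m-1} = α`. -/
theorem alpha_pow_eq_beta_pow {m : ℕ} (hm : 2 ≤ m) : alpha m ^ m = beta m ^ (m - 1) := by
  have h : initialProd (conjOrbit (alpha m) (sigmaSeq m 0)) (m - 1) = alpha m := by
    rw [alpha_eq m]
    unfold initialProd
    congr 1
    refine List.map_congr_left fun i hi => ?_
    have := conjOrbit_alpha (List.mem_range.mp hi)
    rwa [alpha_eq m] at this
  rw [beta_eq hm, mul_pow_eq_initialProd, h, mul_inv_cancel_right, ← pow_succ',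
    Nat.sub_add_cancel (by omega)]

theorem sigmaSeq_zero_eq {m : ℕ} (hm : 2 ≤ m) : sigmaSeq m 0 = (alpha m)⁻¹ * beta m := by
  rw [beta_eq hm, inv_mul_cancel_left]

theorem closure_alpha_beta (m : ℕ) :
    Subgroup.closure {alpha m, beta m} = (⊤ : Subgroup (BraidGroup m)) := by
  rcases Nat.lt_or_ge m 2 with hm | hm
  · have := subsingleton_of_le_one (by omega : m ≤ 1)
    exact Subsingleton.elim _ _
  rw [eq_top_iff, ← PresentedGroup.closure_range_of, Subgroup.closure_le]
  rintro _ ⟨i, rfl⟩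
  have ha : alpha m ∈ Subgroup.closure {alpha m, beta m} := Subgroup.subset_closure (by simp)
  have hb : beta m ∈ Subgroup.closure {alpha m, beta m} := Subgroup.subset_closure (by simp)
  have hi := (conjOrbit_alpha i.2).trans (sigmaSeq_of_lt i.2)
  change sigma m i ∈ _
  rw [← hi, conjOrbit, sigmaSeq_zero_eq hm]
  exact mul_mem (mul_mem (pow_mem ha _) (mul_mem (inv_mem ha) hb)) (inv_mem (pow_mem ha _))

theorem commute_alpha_pow (m : ℕ) (x : BraidGroup m) : Commute (alpha m ^ m) x := by
  rcases Nat.lt_or_ge m 2 with hm | hm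
  · have := subsingleton_of_le_one (by omega : m ≤ 1)
    exact Subsingleton.elim _ _
  have hx : x ∈ Subgroup.closure {alpha m, beta m} := closure_alpha_beta m ▸ trivial
  suffices h : Subgroup.closure {alpha m, beta m} ≤ Subgroup.centralizer {alpha m ^ m} from
    Subgroup.mem_centralizer_iff.mp (h hx) _ rfl
  rw [Subgroup.closure_le]
  rintro y (rfl | rfl) <;> refine Subgroup.mem_centralizer_iff.mpr ?_ <;> rintro _ rfl
  · exact (Commute.refl (alpha m)).pow_left m
  · rw [alpha_pow_eq_beta_pow hm]
    exact (Commute.refl (beta m)).pow_left (m - 1)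

theorem commute_alpha_zpow {m : ℕ} {j : ℤ} (h : (m : ℤ) ∣ j) (x : BraidGroup m) :
    Commute (alpha m ^ j) x := by
  obtain ⟨c, rfl⟩ := h
  rw [zpow_mul, zpow_natCast]
  exact (commute_alpha_pow m x).zpow_left c

theorem commute_beta_zpow {m : ℕ} (hm : 2 ≤ m) {j : ℤ} (h : (m : ℤ) - 1 ∣ j)
    (x : BraidGroup m) : Commute (beta m ^ j) x := by
  obtain ⟨c, rfl⟩ := h
  rw [show (m : ℤ) - 1 = ((m - 1 : ℕ) : ℤ) by omega, zpow_mul, zpow_natCast,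
    ← alpha_pow_eq_beta_pow hm]
  exact (commute_alpha_pow m x).zpow_left c

/-! ### Exponent sums. -/

/-- The exponent sum homomorphism. -/
def degree (m : ℕ) : BraidGroup m →* Multiplicative ℤ :=
  PresentedGroup.toGroup (rels := braidRelators m) (f := fun _ => Multiplicative.ofAdd 1) (by
    rintro r (⟨i, j, -, rfl⟩ | ⟨i, j, -, rfl⟩) <;> simp)

theorem degree_sigma (m : ℕ) (i : Fin (m - 1)) :
    degree m (sigma m i) = Multiplicative.ofAdd 1 :=
  PresentedGroup.toGroup.of _

theorem toAdd_degree_alpha {m : ℕ} (hm : 2 ≤ m) :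
    (degree m (alpha m)).toAdd = (m : ℤ) - 1 := by
  have h : degree m (alpha m) = Multiplicative.ofAdd 1 ^ (m - 1) := by
    rw [alpha, map_list_prod, List.map_map, List.prod_eq_pow_card _ (Multiplicative.ofAdd (1 : ℤ))]
    · simp
    · simp [degree_sigma]
  rw [h, toAdd_pow]
  simp
  omega

theorem toAdd_degree_beta {m : ℕ} (hm : 2 ≤ m) : (degree m (beta m)).toAdd = (m : ℤ) := by
  rw [beta_eq hm, map_mul, toAdd_mul, toAdd_degree_alpha hm, sigmaSeq_of_lt (by omega),
    degree_sigma]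
  simp

theorem toAdd_degree_conj {m : ℕ} (g x : BraidGroup m) (q : ℤ) :
    (degree m (g * x ^ q * g⁻¹)).toAdd = q * (degree m x).toAdd := by
  simp

/-! ### Images of `B_k`: orders modulo the centre, and the commutative case. -/

section Homomorphisms

variable {k : ℕ} {H : Type*} [Group H] (f : BraidGroup k →* H)

theorem map_conjOrbit {G : Type*} [Group G] (f : G →* H) (a x : G) (i : ℕ) :
    f (conjOrbit a x i) = conjOrbit (f a) (f x) i := by
  simp [conjOrbit]

theorem commute_map_iff (hk : 2 ≤ k) (y : H) (hy : Commute y (f (alpha k))) :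
    Commute y (f (beta k)) ↔ Commute y (f (sigmaSeq k 0)) := by
  constructor <;> intro h
  · rw [sigmaSeq_zero_eq hk, map_mul, map_inv]
    exact hy.inv_right.mul_right h
  · rw [beta_eq hk, map_mul]
    exact hy.mul_right h

theorem commute_map_conjOrbit (d : ℕ) (h2 : 2 ≤ d) (hd : d + 2 ≤ k) :
    Commute (f (sigmaSeq k 0)) (conjOrbit (f (alpha k)) (f (sigmaSeq k 0)) d) := by
  rw [← map_conjOrbit, conjOrbit_alpha (by omega)]
  exact (sigmaSeq_commute 0 d (by omega) (by omega)).map f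

theorem braid_map_conjOrbit (hk : 3 ≤ k) :
    f (sigmaSeq k 0) * conjOrbit (f (alpha k)) (f (sigmaSeq k 0)) 1 * f (sigmaSeq k 0) =
      conjOrbit (f (alpha k)) (f (sigmaSeq k 0)) 1 * f (sigmaSeq k 0) *
        conjOrbit (f (alpha k)) (f (sigmaSeq k 0)) 1 := by
  rw [← map_conjOrbit, conjOrbit_alpha (by omega), ← map_mul, ← map_mul, ← map_mul, ← map_mul,
    sigmaSeq_braid 0 (by omega)]

/-- In a non-commutative image of `B_k`, `k ≠ 4`, the order of `α` modulo the centre is `k`. -/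
theorem dvd_of_commute_alpha (hk3 : 3 ≤ k) (hk : k ≠ 4)
    (hn : ¬ Commute (f (alpha k)) (f (beta k))) {j : ℤ}
    (hj : Commute (f (alpha k) ^ j) (f (beta k))) : (k : ℤ) ∣ j := by
  rw [commute_map_iff f (by omega) _ (Commute.refl _)] at hn
  rw [commute_map_iff f (by omega) _ ((Commute.refl _).zpow_left j)] at hj
  refine dvd_of_commute_pow_left hk3 hk (commute_map_conjOrbit f) (braid_map_conjOrbit f hk3)
    ?_ hn hj
  rw [← map_pow]
  exact (commute_alpha_pow k _).map f

/-- In a non-commutative image of `B_k`, `k ≠ 4`, the order of `β` modulo the centre is `k - 1`. -/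
theorem dvd_of_commute_beta (hk3 : 3 ≤ k) (hk : k ≠ 4)
    (hn : ¬ Commute (f (alpha k)) (f (beta k))) {j : ℤ}
    (hj : Commute (f (beta k) ^ j) (f (alpha k))) : (k : ℤ) - 1 ∣ j := by
  have hj' := (commute_map_iff f (by omega) _ hj).mp ((Commute.refl _).zpow_left j)
  rw [commute_map_iff f (by omega) _ (Commute.refl _)] at hn
  rw [beta_eq (by omega), map_mul] at hj'
  refine dvd_of_commute_pow_right hk3 hk (commute_map_conjOrbit f) (braid_map_conjOrbit f hk3)
    ?_ hn hj'
  rw [← map_mul, ← beta_eq (by omega), ← map_pow, ← alpha_pow_eq_beta_pow (by omega)]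
  exact (commute_alpha_pow k _).map f

/-- All `σ_i` are conjugate under powers of `α`, so they have the same image once `f(α)` commutes
with `f(σ_1)`. -/
theorem range_eq_zpowers (hk : 2 ≤ k) (hc : Commute (f (alpha k)) (f (beta k))) :
    f.range = Subgroup.zpowers (f (sigmaSeq k 0)) := by
  rw [commute_map_iff f hk _ (Commute.refl _)] at hc
  refine le_antisymm ?_ ((Subgroup.zpowers_le).mpr ⟨_, rfl⟩)
  rw [MonoidHom.range_eq_map, ← PresentedGroup.closure_range_of, MonoidHom.map_closure,
    Subgroup.closure_le]
  rintro _ ⟨_, ⟨i, rfl⟩, rfl⟩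
  have hi := (conjOrbit_alpha i.2).trans (sigmaSeq_of_lt i.2)
  change f (sigma k i) ∈ _
  rw [← hi, map_conjOrbit, conjOrbit, (hc.pow_left _).eq, mul_inv_cancel_right]
  exact Subgroup.mem_zpowers _

end Homomorphisms

/-! ### Special homomorphisms. -/

theorem commute_alpha_beta_of_le_two {k : ℕ} (hk : k ≤ 2) : Commute (alpha k) (beta k) := by
  rcases Nat.lt_or_ge k 2 with h | h
  · have := subsingleton_of_le_one (by omega : k ≤ 1)
    exact Subsingleton.elim _ _
  · obtain rfl : k = 2 := by omega
    have h1 : alpha 2 = sigmaSeq 2 0 := by rw [alpha_eq]; simp [initialProd]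
    rw [beta_eq le_rfl, ← h1]
    exact (Commute.refl _).mul_right (Commute.refl _)

/-- For `n ≥ 2` the degrees `n - 1` and `n` of `α` and `β` are nonzero, so degree zero forces
exponent zero. Pulling back by `ψ` reduces to this standard pair. -/
theorem eq_one_of_mem_conjPowers {n : ℕ} {a b x : BraidGroup n} (ψ : BraidGroup n ≃* BraidGroup n)
    (ha : ψ (alpha n) = a) (hb : ψ (beta n) = b) (hx : x ∈ conjPowers a b)
    (hd : degree n (ψ.symm x) = 1) : x = 1 := by
  rcases Nat.lt_or_ge n 2 with hn | hn
  · have := subsingleton_of_le_one (by omega : n ≤ 1)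
    exact Subsingleton.elim _ _
  obtain ⟨g, p, rfl | rfl⟩ := hx <;> subst ha hb
  · have h := congrArg Multiplicative.toAdd hd
    simp [toAdd_degree_alpha hn] at h
    have hp : p = 0 := by
      rcases h with h | h
      · exact h
      · omega
    simp [hp]
  · have h := congrArg Multiplicative.toAdd hd
    simp [toAdd_degree_beta hn] at h
    have hp : p = 0 := by
      rcases h with h | h
      · exact h
      · omega
    simp [hp]

theorem alpha_mem_conjPowers {m : ℕ} (a b : BraidGroup m) : a ∈ conjPowers a b :=
  ⟨1, 1, Or.inl (by simp)⟩

theorem beta_mem_conjPowers {m : ℕ} (a b : BraidGroup m) : b ∈ conjPowers a b :=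
  ⟨1, 1, Or.inr (by simp)⟩

/-- A special homomorphism with commutative image is integral. -/
theorem IsSpecialHom.isIntegralHom_of_commute {k n : ℕ} {φ : BraidGroup k →* BraidGroup n}
    (hφ : IsSpecialHom φ) (hc : Commute (φ (alpha k)) (φ (beta k))) : IsIntegralHom φ := by
  rcases Nat.lt_or_ge k 2 with hk | hk
  · have := subsingleton_of_le_one (by omega : k ≤ 1)
    have hr : ∀ x ∈ φ.range, x = 1 := by
      rintro _ ⟨y, rfl⟩
      rw [Subsingleton.elim y 1, map_one]
    have : Subsingleton φ.range :=
      ⟨fun x y => Subtype.ext ((hr x x.2).trans (hr y y.2).symm)⟩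
    exact ⟨inferInstance, fun x hx _ => hr x hx⟩
  obtain ⟨a, b, ⟨ψ, ha, hb⟩, hsub⟩ := hφ
  unfold IsIntegralHom
  rw [range_eq_zpowers φ hk hc]
  refine ⟨inferInstance, ?_⟩
  rintro _ ⟨m, rfl⟩ hfin
  obtain ⟨N, hN, hpow⟩ := isOfFinOrder_iff_pow_eq_one.mp hfin
  dsimp only at hpow ⊢
  have h1 := congrArg (fun y => (degree n (ψ.symm y)).toAdd) hpow
  simp only [map_pow, map_zpow, toAdd_pow, toAdd_zpow, map_one, toAdd_one, smul_eq_mul,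
    nsmul_eq_mul, mul_eq_zero, Nat.cast_eq_zero, hN.ne', false_or] at h1
  rcases h1 with rfl | h1
  · simp
  -- The generator `φ(σ_1)` now has pulled-back degree zero, hence so has the whole image.
  -- Specialness then kills `φ(α)` and `φ(β)`; torsion freeness of `B_n` is not needed.
  have hall : ∀ y, φ y ∈ conjPowers a b → φ y = 1 := fun y hy => by
    refine eq_one_of_mem_conjPowers ψ ha hb hy ?_
    have hy' : φ y ∈ φ.range := ⟨y, rfl⟩
    rw [range_eq_zpowers φ hk hc] at hy'
    obtain ⟨e, he⟩ := hy'
    rw [← he]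
    apply Multiplicative.toAdd.injective
    simp [h1]
  have h2 := hall (alpha k) (hsub ⟨_, alpha_mem_conjPowers _ _, rfl⟩)
  have h3 := hall (beta k) (hsub ⟨_, beta_mem_conjPowers _ _, rfl⟩)
  rw [sigmaSeq_zero_eq hk, map_mul, map_inv, h2, h3]
  simp

theorem IsSpecialSystem.conj {n : ℕ} {a b : BraidGroup n} (h : IsSpecialSystem a b)
    (g : BraidGroup n) : IsSpecialSystem (g⁻¹ * a * g) (g⁻¹ * b * g) := by
  obtain ⟨ψ, rfl, rfl⟩ := h
  exact ⟨ψ.trans (MulAut.conj g⁻¹), by simp, by simp⟩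

/-- Conjugating `(a, b)` by the element that conjugates `φ(α)` keeps the system special and turns
`φ(α)` into an exact power. -/
theorem IsSpecialHom.exists_form {k n : ℕ} {φ : BraidGroup k →* BraidGroup n}
    (hφ : IsSpecialHom φ) :
    ∃ a b : BraidGroup n, IsSpecialSystem a b ∧ ∃ (g : BraidGroup n) (p q : ℤ),
      (φ (alpha k) = a ^ p ∧ φ (beta k) = g * b ^ q * g⁻¹) ∨
      (φ (alpha k) = a ^ p ∧ φ (beta k) = g * a ^ q * g⁻¹) ∨
      (φ (alpha k) = b ^ p ∧ φ (beta k) = g * b ^ q * g⁻¹) ∨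
      (φ (alpha k) = b ^ p ∧ φ (beta k) = g * a ^ q * g⁻¹) := by
  obtain ⟨a, b, hab, hsub⟩ := hφ
  obtain ⟨g, p, hg⟩ := hsub ⟨_, alpha_mem_conjPowers _ _, rfl⟩
  obtain ⟨h, q, hh⟩ := hsub ⟨_, beta_mem_conjPowers _ _, rfl⟩
  have e1 : ∀ (c : BraidGroup n) (r : ℤ), g⁻¹ * c ^ r * g = (g⁻¹ * c * g) ^ r := fun c r => by
    simpa using (conj_zpow (i := r) (a := g⁻¹) (b := c)).symm
  have e2 : ∀ (c : BraidGroup n) (r : ℤ),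
      h⁻¹ * c ^ r * h = h⁻¹ * g * (g⁻¹ * c * g) ^ r * (h⁻¹ * g)⁻¹ := fun c r => by
    rw [← e1]; group
  refine ⟨_, _, hab.conj g, h⁻¹ * g, p, q, ?_⟩
  rw [← e2, ← e2, ← e1, ← e1]
  tauto

/-! ### Arithmetic of `n`, `p`, `q`. -/

/-- With `d = gcd(s, k)`, test `h` on `j = k/d`: `p * (k/d) = N * (s/d)`, so `k ∣ k/d` and `d = 1`.
-/
theorem isCoprime_of_dvd_imp {N k p s : ℤ} (hk : k ≠ 0) (he : p * k = N * s)
    (h : ∀ j, N ∣ p * j → k ∣ j) : IsCoprime s k := by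
  rw [Int.isCoprime_iff_gcd_eq_one]
  obtain ⟨s', hs⟩ := Int.gcd_dvd_left s k
  obtain ⟨k', hk'⟩ := Int.gcd_dvd_right s k
  set d : ℤ := (Int.gcd s k : ℤ) with hd
  have hd0 : d ≠ 0 := by rintro h0; rw [h0, zero_mul] at hk'; exact hk hk'
  have hk0 : k' ≠ 0 := by rintro h0; rw [h0, mul_zero] at hk'; exact hk hk'
  obtain ⟨e, hee⟩ := h k' ⟨s', mul_left_cancel₀ hd0 (by
    rw [hs] at he; rw [hk'] at he; linear_combination he)⟩
  have h1 : d * e = 1 := mul_right_cancel₀ hk0 (by rw [one_mul]; nth_rw 2 [hee]; rw [hk']; ring)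
  have h2 : d = 1 := Int.eq_one_of_mul_eq_one_right (by positivity) h1
  rw [hd] at h2
  exact_mod_cast h2

theorem int_eq_mul_pred_of_dvd {k n : ℤ} (h1 : k ∣ n) (h2 : k - 1 ∣ n) :
    ∃ l, n = l * k * (k - 1) := by
  have hc : IsCoprime k (k - 1) := ⟨1, -1, by ring⟩
  obtain ⟨l, hl⟩ := hc.mul_dvd h1 h2
  exact ⟨l, by rw [hl]; ring⟩

theorem exists_common_factor {k n x y : ℤ} (hn : n ≠ 0)
    (h : k * (x * n) = (k - 1) * (y * n)) : ∃ t, x = t * (k - 1) ∧ y = t * k := by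
  have h' : k * x = (k - 1) * y := mul_right_cancel₀ hn (by linear_combination h)
  refine ⟨y - x, ?_, ?_⟩ <;> linear_combination h'

theorem exists_common_multiple {k n x y : ℤ}
    (h : k * (x * (n - 1)) = (k - 1) * (y * n)) :
    ∃ s, x * k = n * s ∧ y * (k - 1) = (n - 1) * s := by
  refine ⟨x * k - y * (k - 1), ?_, ?_⟩ <;> linear_combination -h

section Arithmetic

variable {k n : ℕ}

theorem mem_progression_of_int {c : ℕ} (hk : 1 ≤ k) (l : ℤ) (hl : 0 ≤ l)
    (h : (n : ℤ) = c + l * (k * (k - 1))) : n ∈ progression k c := by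
  lift l to ℕ using hl
  refine ⟨l, ?_⟩
  zify [hk]
  exact h

/-- The four arithmetical cases for the standard special system of generators. -/
theorem arithmetic_standard (hk3 : 3 ≤ k) (hk : k ≠ 4) (hn2 : 2 ≤ n)
    (φ : BraidGroup k →* BraidGroup n) (hc : ¬ Commute (φ (alpha k)) (φ (beta k)))
    (g : BraidGroup n) (p q : ℤ) :
    (φ (alpha k) = alpha n ^ p → φ (beta k) = g * beta n ^ q * g⁻¹ →
      n ∈ P1 k ∧ ∃ l t : ℤ, 0 ≤ l ∧ (n : ℤ) = k + l * k * (k - 1) ∧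
        Int.gcd t (k * (k - 1)) = 1 ∧ p = t * (l * (k - 1) + 1) ∧ q = t * (l * k + 1)) ∧
    (φ (alpha k) = alpha n ^ p → φ (beta k) = g * alpha n ^ q * g⁻¹ →
      n ∈ P2 k ∧ ∃ l t : ℤ, 1 ≤ l ∧ (n : ℤ) = l * k * (k - 1) ∧
        Commute g (alpha n ^ (t * k * (k - 1))) ∧ p = t * (k - 1) ∧ q = t * k) ∧
    (φ (alpha k) = beta n ^ p → φ (beta k) = g * beta n ^ q * g⁻¹ →
      n ∈ P3 k ∧ ∃ l t : ℤ, 1 ≤ l ∧ (n : ℤ) = l * k * (k - 1) + 1 ∧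
        Commute g (beta n ^ (t * k * (k - 1))) ∧ p = t * (k - 1) ∧ q = t * k) ∧
    (φ (alpha k) = beta n ^ p → φ (beta k) = g * alpha n ^ q * g⁻¹ →
      n ∈ P4 k ∧ ∃ l t : ℤ, 1 ≤ l ∧ (n : ℤ) = (k - 1) * (l * k - 1) ∧
        Int.gcd t (k * (k - 1)) = 1 ∧ p = t * (l * (k - 1) - 1) ∧ q = t * (l * k - 1)) := by
  have hk3' : (3 : ℤ) ≤ k := by exact_mod_cast hk3
  have hn2' : (2 : ℤ) ≤ n := by exact_mod_cast hn2
  have hrel : φ (alpha k) ^ k = φ (beta k) ^ (k - 1) := by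
    rw [← map_pow, ← map_pow, alpha_pow_eq_beta_pow (by omega)]
  have hdeg : (k : ℤ) * (degree n (φ (alpha k))).toAdd =
      (k - 1) * (degree n (φ (beta k))).toAdd := by
    have h := congrArg (fun y => (degree n y).toAdd) hrel
    simp only [map_pow, toAdd_pow, nsmul_eq_mul] at h
    rwa [Nat.cast_sub (by omega), Nat.cast_one] at h
  have hA := fun j => dvd_of_commute_alpha φ hk3 hk hc (j := j)
  have hB := fun j => dvd_of_commute_beta φ hk3 hk hc (j := j)
  have dα := toAdd_degree_alpha hn2
  have dβ := toAdd_degree_beta hn2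
  have A1 : φ (alpha k) = alpha n ^ p → ∀ j, (n : ℤ) ∣ p * j → (k : ℤ) ∣ j := fun e j h =>
    hA j (by rw [e, ← zpow_mul]; exact commute_alpha_zpow h _)
  have A2 : φ (alpha k) = beta n ^ p → ∀ j, (n : ℤ) - 1 ∣ p * j → (k : ℤ) ∣ j := fun e j h =>
    hA j (by rw [e, ← zpow_mul]; exact commute_beta_zpow hn2 h _)
  have B1 : φ (beta k) = g * alpha n ^ q * g⁻¹ → ∀ j, (n : ℤ) ∣ q * j → (k : ℤ) - 1 ∣ j :=
    fun e j h => hB j (by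
      rw [e, conj_zpow, ← zpow_mul, ← (commute_alpha_zpow h g).eq, mul_inv_cancel_right]
      exact commute_alpha_zpow h _)
  have B2 : φ (beta k) = g * beta n ^ q * g⁻¹ → ∀ j, (n : ℤ) - 1 ∣ q * j → (k : ℤ) - 1 ∣ j :=
    fun e j h => hB j (by
      rw [e, conj_zpow, ← zpow_mul, ← (commute_beta_zpow hn2 h g).eq, mul_inv_cancel_right]
      exact commute_beta_zpow hn2 h _)
  -- Here `φ(α)^k = φ(β)^(k-1)` reads `u^(tk(k-1)) = g u^(tk(k-1)) g⁻¹`.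
  have hcomm : ∀ (u : BraidGroup n) (t : ℤ), φ (alpha k) = u ^ (t * (k - 1)) →
      φ (beta k) = g * u ^ (t * k) * g⁻¹ → Commute g (u ^ (t * k * (k - 1))) := by
    intro u t e1 e2
    have h := hrel
    rw [← zpow_natCast, ← zpow_natCast, e1, e2, conj_zpow, ← zpow_mul, ← zpow_mul,
      Nat.cast_sub (by omega), Nat.cast_one, mul_right_comm, eq_mul_inv_iff_mul_eq] at h
    exact h.symm
  refine ⟨fun e1 e2 => ?_, fun e1 e2 => ?_, fun e1 e2 => ?_, fun e1 e2 => ?_⟩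
  · rw [e2, toAdd_degree_conj, e1, map_zpow, toAdd_zpow, dα, dβ, smul_eq_mul] at hdeg
    obtain ⟨s, hs1, hs2⟩ := exists_common_multiple hdeg
    have c1 := isCoprime_of_dvd_imp (by omega) hs1 (A1 e1)
    have c2 := isCoprime_of_dvd_imp (by omega) hs2 (B2 e2)
    have d1 : (k : ℤ) ∣ n := c1.symm.dvd_of_dvd_mul_right ⟨p, by rw [← hs1, mul_comm]⟩
    have d2 : (k : ℤ) - 1 ∣ n - 1 := c2.symm.dvd_of_dvd_mul_right ⟨q, by rw [← hs2, mul_comm]⟩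
    -- Since `n ≡ 0` mod `k` and `n ≡ 1` mod `k - 1`, both moduli divide `n - k`.
    obtain ⟨l, hl⟩ := int_eq_mul_pred_of_dvd (k := (k : ℤ)) (n := n - k)
      (dvd_sub_self_right.mpr d1) (by
        have := dvd_sub d2 (dvd_refl ((k : ℤ) - 1)); rwa [sub_sub_sub_cancel_right] at this)
    have hln : (n : ℤ) = k + l * k * (k - 1) := by linear_combination hl
    have hkn : (k : ℤ) ≤ n := Int.le_of_dvd (by omega) d1
    have hl0 : 0 ≤ l := by
      by_contra hneg
      nlinarith [mul_pos (by omega : (0 : ℤ) < k) (by omega : (0 : ℤ) < k - 1)]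
    refine ⟨mem_progression_of_int (by omega) l hl0 (by rw [hln]; ring), l, s, hl0, hln,
      Int.isCoprime_iff_gcd_eq_one.mp (c1.mul_right c2), ?_, ?_⟩
    · exact mul_right_cancel₀ (by omega : (k : ℤ) ≠ 0) (by rw [hs1, hln]; ring)
    · exact mul_right_cancel₀ (by omega : (k : ℤ) - 1 ≠ 0) (by rw [hs2, hln]; ring)
  · rw [e2, toAdd_degree_conj, e1, map_zpow, toAdd_zpow, dα, smul_eq_mul] at hdeg
    obtain ⟨t, ht1, ht2⟩ := exists_common_factor (by omega) hdeg
    -- The test exponent `j = n` makes both powers central, so `k` and `k - 1` divide `n`.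
    obtain ⟨l, hl⟩ := int_eq_mul_pred_of_dvd (A1 e1 n (dvd_mul_left _ _))
      (B1 e2 n (dvd_mul_left _ _))
    have hl1 : 1 ≤ l := by
      by_contra hneg
      nlinarith [mul_pos (by omega : (0 : ℤ) < k) (by omega : (0 : ℤ) < k - 1)]
    refine ⟨mem_progression_of_int (by omega) (l - 1) (by omega) ?_, l, t, hl1, hl,
      hcomm _ t (ht1 ▸ e1) (ht2 ▸ e2), ht1, ht2⟩
    rw [Nat.cast_mul, Nat.cast_sub (by omega), Nat.cast_one]
    linear_combination hl
  · rw [e2, toAdd_degree_conj, e1, map_zpow, toAdd_zpow, dβ, smul_eq_mul] at hdeg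
    obtain ⟨t, ht1, ht2⟩ := exists_common_factor (by omega) hdeg
    obtain ⟨l, hl⟩ := int_eq_mul_pred_of_dvd (A2 e1 (n - 1) (dvd_mul_left _ _))
      (B2 e2 (n - 1) (dvd_mul_left _ _))
    have hl1 : 1 ≤ l := by
      by_contra hneg
      nlinarith [mul_pos (by omega : (0 : ℤ) < k) (by omega : (0 : ℤ) < k - 1)]
    refine ⟨mem_progression_of_int (by omega) (l - 1) (by omega) ?_, l, t, hl1,
      by linear_combination hl, hcomm _ t (ht1 ▸ e1) (ht2 ▸ e2), ht1, ht2⟩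
    rw [Nat.cast_add, Nat.cast_mul, Nat.cast_sub (by omega), Nat.cast_one]
    linear_combination hl
  · rw [e2, toAdd_degree_conj, e1, map_zpow, toAdd_zpow, dα, dβ, smul_eq_mul] at hdeg
    obtain ⟨s, hs1, hs2⟩ : ∃ s, p * k = ((n : ℤ) - 1) * s ∧ q * ((k : ℤ) - 1) = n * s := by
      refine ⟨q * (k - 1) - p * k, ?_, ?_⟩ <;> linear_combination hdeg
    have c1 := isCoprime_of_dvd_imp (by omega) hs1 (A2 e1)
    have c2 := isCoprime_of_dvd_imp (by omega) hs2 (B1 e2)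
    have d1 : (k : ℤ) ∣ n - 1 := c1.symm.dvd_of_dvd_mul_right ⟨p, by rw [← hs1, mul_comm]⟩
    have d2 : (k : ℤ) - 1 ∣ n := c2.symm.dvd_of_dvd_mul_right ⟨q, by rw [← hs2, mul_comm]⟩
    -- Now `n ≡ 1` mod `k` and `n ≡ 0` mod `k - 1`, so both moduli divide `n + (k - 1)`.
    obtain ⟨l, hl⟩ := int_eq_mul_pred_of_dvd (k := (k : ℤ)) (n := n + (k - 1))
      (by have := dvd_add d1 (dvd_refl (k : ℤ)); rwa [sub_add_comm, add_comm] at this)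
      (dvd_add d2 (dvd_refl _))
    have hln : (n : ℤ) = (k - 1) * (l * k - 1) := by linear_combination hl
    have hl1 : 1 ≤ l := by
      by_contra hneg
      nlinarith [mul_pos (by omega : (0 : ℤ) < k) (by omega : (0 : ℤ) < k - 1)]
    refine ⟨mem_progression_of_int (by omega) (l - 1) (by omega) ?_, l, s, hl1, hln,
      Int.isCoprime_iff_gcd_eq_one.mp (c1.mul_right c2), ?_, ?_⟩
    · rw [Nat.cast_pow, Nat.cast_sub (by omega), Nat.cast_one, hln]; ring
    · exact mul_right_cancel₀ (by omega : (k : ℤ) ≠ 0) (by rw [hs1, hln]; ring)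
    · exact mul_right_cancel₀ (by omega : (k : ℤ) - 1 ≠ 0) (by rw [hs2, hln]; ring)

/-- The four arithmetical cases for an arbitrary special system of generators. -/
theorem arithmetic_of_isSpecialSystem (hk : k ≠ 4) (φ : BraidGroup k →* BraidGroup n)
    (hc : ¬ Commute (φ (alpha k)) (φ (beta k))) {a b : BraidGroup n} (hab : IsSpecialSystem a b)
    (g : BraidGroup n) (p q : ℤ) :
    (φ (alpha k) = a ^ p → φ (beta k) = g * b ^ q * g⁻¹ →
      n ∈ P1 k ∧ ∃ l t : ℤ, 0 ≤ l ∧ (n : ℤ) = k + l * k * (k - 1) ∧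
        Int.gcd t (k * (k - 1)) = 1 ∧ p = t * (l * (k - 1) + 1) ∧ q = t * (l * k + 1)) ∧
    (φ (alpha k) = a ^ p → φ (beta k) = g * a ^ q * g⁻¹ →
      n ∈ P2 k ∧ ∃ l t : ℤ, 1 ≤ l ∧ (n : ℤ) = l * k * (k - 1) ∧
        Commute g (a ^ (t * k * (k - 1))) ∧ p = t * (k - 1) ∧ q = t * k) ∧
    (φ (alpha k) = b ^ p → φ (beta k) = g * b ^ q * g⁻¹ →
      n ∈ P3 k ∧ ∃ l t : ℤ, 1 ≤ l ∧ (n : ℤ) = l * k * (k - 1) + 1 ∧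
        Commute g (b ^ (t * k * (k - 1))) ∧ p = t * (k - 1) ∧ q = t * k) ∧
    (φ (alpha k) = b ^ p → φ (beta k) = g * a ^ q * g⁻¹ →
      n ∈ P4 k ∧ ∃ l t : ℤ, 1 ≤ l ∧ (n : ℤ) = (k - 1) * (l * k - 1) ∧
        Int.gcd t (k * (k - 1)) = 1 ∧ p = t * (l * (k - 1) - 1) ∧ q = t * (l * k - 1)) := by
  have hk3 : 3 ≤ k := by
    by_contra h
    exact hc ((commute_alpha_beta_of_le_two (by omega)).map φ)
  have hn2 : 2 ≤ n := by
    by_contra h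
    have := subsingleton_of_le_one (by omega : n ≤ 1)
    exact hc (Subsingleton.elim _ _)
  obtain ⟨ψ, rfl, rfl⟩ := hab
  have hinj : Function.Injective ψ.symm := ψ.symm.injective
  have hc' : ¬ Commute ((ψ.symm : BraidGroup n →* BraidGroup n).comp φ (alpha k))
      ((ψ.symm : BraidGroup n →* BraidGroup n).comp φ (beta k)) := fun h =>
    hc (by simpa using h.map ψ)
  have e1 : ∀ (x u : BraidGroup n) (r : ℤ), x = ψ u ^ r → ψ.symm x = u ^ r := by
    rintro _ u r rfl; simp
  have e2 : ∀ (x u : BraidGroup n) (r : ℤ), x = g * ψ u ^ r * g⁻¹ →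
      ψ.symm x = ψ.symm g * u ^ r * (ψ.symm g)⁻¹ := by
    rintro _ u r rfl; simp
  have e3 : ∀ (u : BraidGroup n) (r : ℤ), Commute (ψ.symm g) (u ^ r) → Commute g (ψ u ^ r) :=
    fun u r h => by simpa using h.map ψ
  -- Composing `φ` with `ψ⁻¹` replaces `(a, b)` by the standard pair `(α, β)`.
  obtain ⟨h1, h2, h3, h4⟩ := arithmetic_standard hk3 hk hn2 _ hc' (ψ.symm g) p q
  refine ⟨fun i j => h1 (e1 _ _ _ i) (e2 _ _ _ j), fun i j => ?_, fun i j => ?_,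
    fun i j => h4 (e1 _ _ _ i) (e2 _ _ _ j)⟩
  · obtain ⟨m, l, t, hl, hn, hg, hpq⟩ := h2 (e1 _ _ _ i) (e2 _ _ _ j)
    exact ⟨m, l, t, hl, hn, e3 _ _ hg, hpq⟩
  · obtain ⟨m, l, t, hl, hn, hg, hpq⟩ := h3 (e1 _ _ _ i) (e2 _ _ _ j)
    exact ⟨m, l, t, hl, hn, e3 _ _ hg, hpq⟩

end Arithmetic

end BraidGroup

/-! ### The main theorem. -/

theorem theoremH (k n : ℕ) (hk : k ≠ 4) :
    (∀ φ : BraidGroup k →* BraidGroup n,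
      BraidGroup.IsSpecialHom φ → ¬ BraidGroup.IsIntegralHom φ →
      n ∈ BraidGroup.P k ∧
      -- at least one of the four possible forms occurs
      (∃ a b : BraidGroup n, BraidGroup.IsSpecialSystem a b ∧
        ∃ (g : BraidGroup n) (p q : ℤ),
          (φ (BraidGroup.alpha k) = a ^ p ∧ φ (BraidGroup.beta k) = g * b ^ q * g⁻¹) ∨
          (φ (BraidGroup.alpha k) = a ^ p ∧ φ (BraidGroup.beta k) = g * a ^ q * g⁻¹) ∨
          (φ (BraidGroup.alpha k) = b ^ p ∧ φ (BraidGroup.beta k) = g * b ^ q * g⁻¹) ∨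
          (φ (BraidGroup.alpha k) = b ^ p ∧ φ (BraidGroup.beta k) = g * a ^ q * g⁻¹)) ∧
      -- and whenever one of them occurs, `n`, `p`, `q` and `g` are as follows
      (∀ a b : BraidGroup n, BraidGroup.IsSpecialSystem a b →
        ∀ (g : BraidGroup n) (p q : ℤ),
          (φ (BraidGroup.alpha k) = a ^ p → φ (BraidGroup.beta k) = g * b ^ q * g⁻¹ →
            n ∈ BraidGroup.P1 k ∧
            ∃ l t : ℤ, 0 ≤ l ∧ (n : ℤ) = k + l * k * (k - 1) ∧
              Int.gcd t (k * (k - 1)) = 1 ∧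
              p = t * (l * (k - 1) + 1) ∧ q = t * (l * k + 1)) ∧
          (φ (BraidGroup.alpha k) = a ^ p → φ (BraidGroup.beta k) = g * a ^ q * g⁻¹ →
            n ∈ BraidGroup.P2 k ∧
            ∃ l t : ℤ, 1 ≤ l ∧ (n : ℤ) = l * k * (k - 1) ∧
              Commute g (a ^ (t * k * (k - 1))) ∧
              p = t * (k - 1) ∧ q = t * k) ∧
          (φ (BraidGroup.alpha k) = b ^ p → φ (BraidGroup.beta k) = g * b ^ q * g⁻¹ →
            n ∈ BraidGroup.P3 k ∧
            ∃ l t : ℤ, 1 ≤ l ∧ (n : ℤ) = l * k * (k - 1) + 1 ∧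
              Commute g (b ^ (t * k * (k - 1))) ∧
              p = t * (k - 1) ∧ q = t * k) ∧
          (φ (BraidGroup.alpha k) = b ^ p → φ (BraidGroup.beta k) = g * a ^ q * g⁻¹ →
            n ∈ BraidGroup.P4 k ∧
            ∃ l t : ℤ, 1 ≤ l ∧ (n : ℤ) = (k - 1) * (l * k - 1) ∧
              Int.gcd t (k * (k - 1)) = 1 ∧
              p = t * (l * (k - 1) - 1) ∧ q = t * (l * k - 1)))) ∧
    (n ∉ BraidGroup.P k →
      ∀ φ : BraidGroup k →* BraidGroup n,
        BraidGroup.IsSpecialHom φ → BraidGroup.IsIntegralHom φ) := by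
  have main : ∀ φ : BraidGroup k →* BraidGroup n,
      BraidGroup.IsSpecialHom φ → ¬ BraidGroup.IsIntegralHom φ →
      ¬ Commute (φ (BraidGroup.alpha k)) (φ (BraidGroup.beta k)) :=
    fun φ hs hi hc => hi (hs.isIntegralHom_of_commute hc)
  have mem : ∀ φ : BraidGroup k →* BraidGroup n,
      BraidGroup.IsSpecialHom φ → ¬ BraidGroup.IsIntegralHom φ → n ∈ BraidGroup.P k := by
    intro φ hs hi
    obtain ⟨a, b, hab, g, p, q, h⟩ := hs.exists_form
    obtain ⟨h1, h2, h3, h4⟩ :=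
      BraidGroup.arithmetic_of_isSpecialSystem hk φ (main φ hs hi) hab g p q
    rcases h with h | h | h | h
    · exact Or.inl (Or.inl (Or.inl (h1 h.1 h.2).1))
    · exact Or.inl (Or.inl (Or.inr (h2 h.1 h.2).1))
    · exact Or.inl (Or.inr (h3 h.1 h.2).1)
    · exact Or.inr (h4 h.1 h.2).1
  exact ⟨fun φ hs hi => ⟨mem φ hs hi, hs.exists_form, fun a b hab g p q =>
    BraidGroup.arithmetic_of_isSpecialSystem hk φ (main φ hs hi) hab g p q⟩,
    fun hn φ hs => by_contra fun hi => hn (mem φ hs hi)⟩
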